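/- Let $n\geq 3$, let $\mathbb{B}^n=\{x\in\mathbb{R}^n : |x|<1\}$ be the open Euclidean unit ball, and let $h:\mathbb{B}^n\to(-1,1)$ be a harmonic function (that is, $h\in C^2(\mathbb{B}^n)$ and $\Delta h=0$ in $\mathbb{B}^n$). Then, for every $x\in\mathbb{B}^n$, $$ |\nabla h(x)|\leq \frac{n}{2}\,\frac{1-|h(x)|^2}{1-|x|}, $$ where $|\cdot|$ denotes the Euclidean norm. In addition, if $n\geq 4$, this inequality is strict at every $x\in\mathbb{B}^n$. -/

import Mathlib

open MeasureTheory Metric Set Filter Topology Laplacian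
open scoped RealInnerProductSpace

/-! ### Line derivatives of the functions to be integrated by parts. -/

section LineDerivatives

variable {E : Type*} [NormedAddCommGroup E] [InnerProductSpace ℝ E]

/-! At the centre, with `a = g 0`, `D` the derivative along a unit vector `e` and `|g| ≤ 1`, the
mean value formulas give `D / n + a² = avg g(y) (⟪y, e⟫ + a) ≤ avg |⟪y, e⟫ + a|` over the unit
sphere. For `n = 3`, `⟪y, e⟫` is uniform on `[-1, 1]` and the right side is `(1 + a²) / 2`, whence
`D ≤ n (1 - a²) / 2`.

For larger `n` a certificate replaces the exact average: `exists_cap_potential` writes `|y + a|` as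
`(1 + a²) / 2 + 2 k y - (1 - y²) k'`, while `integral_zonal_eq_zero` says `(n - 1) k y - (1 - y²)
k'` has average zero. The average is thus `(1 + a²) / 2 - (n - 3) avg (k y)`, and `k' ≥ c > 0` makes
the last term a strict gain when `n ≥ 4`.

Surface measure is avoided: sphere averages become ball integrals against `ψ (‖y‖ ^ 2)` with `ψ`
living on `[κ, 1]`, at the cost of a factor `κ` (`mul_fderiv_zero_add_le`). A general point `x` is
reached by rescaling a ball of radius `ρ (1 - ‖x‖)` about it and letting `ρ = κ` tend to `1`. -/

/-- Line derivative of a radial function. -/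
theorem hasLineDerivAt_radial {φ φ' : ℝ → ℝ} (hφ : ∀ s, HasDerivAt φ (φ' s) s) (y v : E) :
    HasLineDerivAt ℝ (fun y : E => φ (‖y‖ ^ 2)) (2 * ⟪y, v⟫ * φ' (‖y‖ ^ 2)) y v := by
  have h1 : HasFDerivAt (fun y : E => ‖y‖ ^ 2) (2 • innerSL ℝ y) y :=
    (hasStrictFDerivAt_norm_sq y).hasFDerivAt
  have h2 := ((hφ (‖y‖ ^ 2)).comp_hasFDerivAt y h1).hasLineDerivAt v
  simp only [smul_apply, innerSL_apply_apply, smul_eq_mul, nsmul_eq_mul, Nat.cast_ofNat] at h2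
  rwa [mul_comm (φ' _)] at h2

theorem hasDerivAt_dilation_line (r : ℝ) (y v : E) :
    HasDerivAt (fun t : ℝ => r • (y + t • v)) (r • v) 0 := by
  have h := (((hasDerivAt_id (0 : ℝ)).smul_const v).const_add y).const_smul r
  rw [one_smul] at h
  exact h

theorem hasLineDerivAt_fderiv_dilation {g : E → ℝ} (hg : ContDiff ℝ 2 g) (r : ℝ) (w y v : E) :
    HasLineDerivAt ℝ (fun y => fderiv ℝ g (r • y) w)
      (r * fderiv ℝ (fderiv ℝ g) (r • y) v w) y v := by
  have hd : Differentiable ℝ (fderiv ℝ g) :=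
    (hg.fderiv_right (m := 1) (by norm_num)).differentiable (by norm_num)
  have h := ((hd _).hasFDerivAt.comp_hasDerivAt 0 (hasDerivAt_dilation_line r y v)).clm_apply
    (hasDerivAt_const (0 : ℝ) w)
  simpa [HasLineDerivAt, Function.comp_def] using h

theorem hasLineDerivAt_dilation {g : E → ℝ} (hg : Differentiable ℝ g) (r : ℝ) (y v : E) :
    HasLineDerivAt ℝ (fun y => g (r • y)) (r * fderiv ℝ g (r • y) v) y v := by
  have h := (hg _).hasFDerivAt.comp_hasDerivAt 0 (hasDerivAt_dilation_line r y v)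
  simpa [HasLineDerivAt, Function.comp_def] using h

theorem hasLineDerivAt_inner (e y v : E) : HasLineDerivAt ℝ (fun y => ⟪y, e⟫) ⟪v, e⟫ y v := by
  have h := ((innerSL ℝ e).hasFDerivAt (x := y)).hasLineDerivAt v
  simpa [real_inner_comm] using h

end LineDerivatives

section OrthonormalSums

variable {E : Type*} [NormedAddCommGroup E] [InnerProductSpace ℝ E] [FiniteDimensional ℝ E]

theorem laplacian_eq_sum_fderiv (g : E → ℝ) (y : E) :
    Δ g y = ∑ i, fderiv ℝ (fderiv ℝ g) y (stdOrthonormalBasis ℝ E i)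
      (stdOrthonormalBasis ℝ E i) := by
  rw [InnerProductSpace.laplacian_eq_iteratedFDeriv_stdOrthonormalBasis]
  simp [iteratedFDeriv_two_apply]

theorem clm_eq_sum_inner (L : E →L[ℝ] ℝ) (y : E) :
    L y = ∑ i, L (stdOrthonormalBasis ℝ E i) * ⟪y, stdOrthonormalBasis ℝ E i⟫ := by
  conv_lhs => rw [← (stdOrthonormalBasis ℝ E).sum_repr' y]
  simp [real_inner_comm, mul_comm]

end OrthonormalSums

/-! ### Integration by parts against radial weights. -/

section RadialWeights

variable {E : Type*} [NormedAddCommGroup E] [InnerProductSpace ℝ E] [FiniteDimensional ℝ E]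
  [MeasurableSpace E] [BorelSpace E]

/-- A continuous function times a continuous radial weight supported in the unit ball is
integrable. -/
theorem integrable_mul_radial {F : E → ℝ} {φ : ℝ → ℝ} (hF : Continuous F) (hφ : Continuous φ)
    (h0 : ∀ s, 1 ≤ s → φ s = 0) : Integrable (fun y : E => F y * φ (‖y‖ ^ 2)) := by
  refine Continuous.integrable_of_hasCompactSupport (by fun_prop) ?_
  refine HasCompactSupport.intro (isCompact_closedBall (0 : E) 1) fun y hy => ?_
  have hy1 : 1 < ‖y‖ := by simpa using hy
  rw [h0 _ (by nlinarith), mul_zero]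

/-- Integration by parts against a radial weight supported in the unit ball. -/
theorem integral_mul_inner_mul_radial {f f' : E → ℝ} {φ φ' : ℝ → ℝ} {v : E}
    (hfd : ∀ y, HasLineDerivAt ℝ f (f' y) y v) (hf : Continuous f) (hf' : Continuous f')
    (hφ : ∀ s, HasDerivAt φ (φ' s) s) (hφ' : Continuous φ')
    (h0 : ∀ s, 1 ≤ s → φ s = 0) (h0' : ∀ s, 1 ≤ s → φ' s = 0) :
    2 * ∫ y, f y * ⟪y, v⟫ * φ' (‖y‖ ^ 2) = - ∫ y, f' y * φ (‖y‖ ^ 2) := by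
  have hφc : Continuous φ := continuous_iff_continuousAt.2 fun s => (hφ s).continuousAt
  have key := integral_bilinear_hasLineDerivAt_right_eq_neg_left_of_integrable
    (μ := (volume : Measure E)) (B := ContinuousLinearMap.mul ℝ ℝ) (f := f) (f' := f')
    (g := fun y : E => φ (‖y‖ ^ 2)) (g' := fun y : E => 2 * ⟪y, v⟫ * φ' (‖y‖ ^ 2)) (v := v)
    (integrable_mul_radial hf' hφc h0)
    (by
      have := integrable_mul_radial (E := E) (F := fun y => f y * (2 * ⟪y, v⟫)) (by fun_prop) hφ' h0'
      simpa [mul_assoc] using this)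
    (integrable_mul_radial hf hφc h0) (fun y _ => hfd y) (fun y _ => hasLineDerivAt_radial hφ y v)
  simp only [ContinuousLinearMap.mul_apply'] at key
  rw [← key, ← integral_const_mul]
  congr 1 with y
  ring

/-- The divergence theorem for a vector field given as a finite sum, against a radial weight
supported in the unit ball. -/
theorem integral_sum_mul_inner_mul_radial {ι : Type*} [Fintype ι] {f f' : ι → E → ℝ}
    {φ φ' : ℝ → ℝ} {v : ι → E}
    (hfd : ∀ i y, HasLineDerivAt ℝ (f i) (f' i y) y (v i)) (hf : ∀ i, Continuous (f i))
    (hf' : ∀ i, Continuous (f' i))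
    (hφ : ∀ s, HasDerivAt φ (φ' s) s) (hφ' : Continuous φ')
    (h0 : ∀ s, 1 ≤ s → φ s = 0) (h0' : ∀ s, 1 ≤ s → φ' s = 0) :
    2 * ∫ y, (∑ i, f i y * ⟪y, v i⟫) * φ' (‖y‖ ^ 2) = - ∫ y, (∑ i, f' i y) * φ (‖y‖ ^ 2) := by
  have hφc : Continuous φ := continuous_iff_continuousAt.2 fun s => (hφ s).continuousAt
  simp only [Finset.sum_mul]
  rw [integral_finsetSum, integral_finsetSum, Finset.mul_sum, ← Finset.sum_neg_distrib]
  · exact Finset.sum_congr rfl fun i _ =>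
      integral_mul_inner_mul_radial (hfd i) (hf i) (hf' i) hφ hφ' h0 h0'
  · exact fun i _ => integrable_mul_radial (hf' i) hφc h0
  · exact fun i _ => integrable_mul_radial (F := fun y => f i y * ⟪y, v i⟫)
      ((hf i).mul (by fun_prop)) hφ' h0'

/-- Differentiation of dilations under the integral sign. -/
theorem hasDerivAt_integral_dilation {g : E → ℝ} (hg : ContDiff ℝ 1 g) {F : E → ℝ} {φ : ℝ → ℝ}
    (hF : Continuous F) (hφ : Continuous φ) (h0 : ∀ s, 1 ≤ s → φ s = 0) (r : ℝ) :
    HasDerivAt (fun r : ℝ => ∫ y, g (r • y) * F y * φ (‖y‖ ^ 2))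
      (∫ y, fderiv ℝ g (r • y) y * F y * φ (‖y‖ ^ 2)) r := by
  have hgc := hg.continuous
  have hdc : Continuous (fderiv ℝ g) := hg.continuous_fderiv (by norm_num)
  -- This ball contains every `t • y` with `|t - r| < 1` and `‖y‖ ≤ 1`, so one `C` dominates all
  -- nearby dilations.
  obtain ⟨C, hC⟩ := (isCompact_closedBall (0 : E) (|r| + 1)).exists_bound_of_continuousOn
    hdc.continuousOn
  refine (hasDerivAt_integral_of_dominated_loc_of_deriv_le (s := ball r 1)
    (bound := fun y => ‖C * ‖y‖ * F y * φ (‖y‖ ^ 2)‖)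
    (F := fun (r : ℝ) y => g (r • y) * F y * φ (‖y‖ ^ 2))
    (F' := fun (r : ℝ) y => fderiv ℝ g (r • y) y * F y * φ (‖y‖ ^ 2))
    (ball_mem_nhds r one_pos) ?_ ?_ ?_ ?_ ?_ ?_).2
  · exact Eventually.of_forall fun t => Continuous.aestronglyMeasurable (by fun_prop)
  · exact integrable_mul_radial (F := fun y => g (r • y) * F y) (by fun_prop) hφ h0
  · exact Continuous.aestronglyMeasurable (by fun_prop)
  · refine Eventually.of_forall fun y t ht => ?_
    by_cases hy : ‖y‖ ≤ 1
    · have ht' : |t| ≤ |r| + 1 := by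
        have : |t - r| < 1 := by simpa [Real.dist_eq] using ht
        have := abs_sub_abs_le_abs_sub t r
        linarith
      have hmem : t • y ∈ closedBall (0 : E) (|r| + 1) := by
        rw [mem_closedBall_zero_iff, norm_smul, Real.norm_eq_abs]
        nlinarith [abs_nonneg t, norm_nonneg y]
      have h1 := (fderiv ℝ g (t • y)).le_of_opNorm_le (hC _ hmem) y
      have h2 : ‖fderiv ℝ g (t • y) y‖ ≤ ‖C * ‖y‖‖ := h1.trans (Real.le_norm_self _)
      rw [mul_assoc, mul_assoc (C * ‖y‖), norm_mul, norm_mul (C * ‖y‖)]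
      exact mul_le_mul_of_nonneg_right h2 (norm_nonneg _)
    · rw [h0 (‖y‖ ^ 2) (by nlinarith)]
      simp
  · exact (integrable_mul_radial (F := fun y => C * ‖y‖ * F y) (by fun_prop) hφ h0).norm
  · refine Eventually.of_forall fun y t _ => ?_
    have h1 : HasDerivAt (fun t : ℝ => t • y) y t := by simpa using (hasDerivAt_id t).smul_const y
    have h2 := ((hg.differentiable (by norm_num)) (t • y)).hasFDerivAt.comp_hasDerivAt t h1
    exact (h2.mul_const _).mul_const _

end RadialWeights

/-- A smooth nonnegative bump supported in `(κ, 1)`, with a primitive vanishing on `[1, ∞)`. -/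
theorem exists_radial_weight {κ : ℝ} (hκ0 : 0 < κ) (hκ : κ < 1) :
    ∃ φ ψ ψ' : ℝ → ℝ, (∀ s, HasDerivAt φ (ψ s) s) ∧ (∀ s, HasDerivAt ψ (ψ' s) s) ∧
      Continuous ψ' ∧ (∀ s, 1 ≤ s → φ s = 0) ∧ (∀ s, 1 ≤ s → ψ s = 0) ∧
      (∀ s, 1 ≤ s → ψ' s = 0) ∧ (∀ s, 0 ≤ ψ s) ∧ (∀ s, s ≤ κ → ψ s = 0) ∧
      ∃ s, 0 < s ∧ 0 < ψ s := by
  -- Centred at the midpoint of `[κ, 1]`, with outer radius half its length.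
  let β : ContDiffBump ((1 + κ) / 2 : ℝ) :=
    ⟨(1 - κ) / 4, (1 - κ) / 2, by linarith, by linarith⟩
  have hβ : ContDiff ℝ 2 β := β.contDiff
  have hd : ∀ s, HasDerivAt β (deriv β s) s := fun s =>
    (hβ.differentiable (by norm_num) s).hasDerivAt
  have hdc : Continuous (deriv β) := hβ.continuous_deriv (by norm_num)
  have hz : ∀ s, 1 ≤ s → β s = 0 := fun s hs => by
    apply β.zero_of_le_dist
    rw [Real.dist_eq]
    exact le_trans (by change (1 - κ) / 2 ≤ _; linarith) (le_abs_self _)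
  have hz' : ∀ s, s ≤ κ → β s = 0 := fun s hs => by
    apply β.zero_of_le_dist
    rw [Real.dist_eq]
    exact le_trans (by change (1 - κ) / 2 ≤ _; linarith) (neg_le_abs _)
  refine ⟨fun s => ∫ t in (1 : ℝ)..s, β t, β, deriv β, ?_, hd, hdc, ?_, hz, ?_,
    fun s => β.nonneg, hz', (1 + κ) / 2, by linarith, ?_⟩
  · intro s
    exact intervalIntegral.integral_hasDerivAt_right (hβ.continuous.intervalIntegrable _ _)
      (hβ.continuous.stronglyMeasurableAtFilter _ _) hβ.continuous.continuousAt
  · intro s hs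
    beta_reduce
    rw [intervalIntegral.integral_congr (g := fun _ => (0 : ℝ))]
    · simp
    · intro t ht
      rw [uIcc_of_le hs] at ht
      exact hz t ht.1
  · intro s hs
    have h1 : EqOn (deriv β) 0 (Ioi 1) := fun t ht => by
      have : β =ᶠ[𝓝 t] fun _ => 0 := by
        filter_upwards [Ioi_mem_nhds ht] with u hu using hz u (le_of_lt hu)
      rw [this.deriv_eq]
      simp
    have h2 := h1.closure hdc continuous_const
    rw [closure_Ioi] at h2
    exact h2 hs
  · rw [β.one_of_mem_closedBall (mem_closedBall_self β.rIn_pos.le)]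
    exact one_pos

/-! ### Mean value formulas and moments of the weight. -/

section MeanValue

variable {E : Type*} [NormedAddCommGroup E] [InnerProductSpace ℝ E] [FiniteDimensional ℝ E]
  [MeasurableSpace E] [BorelSpace E]

variable {g : E → ℝ} {φ ψ : ℝ → ℝ}

/-- The field `∇g (r • y)` has divergence `r Δg (r • y)`, which vanishes wherever `φ (‖y‖ ^ 2)` does
not. This makes weighted averages of dilations constant in `r`. -/
theorem integral_fderiv_dilation_eq_zero (hg : ContDiff ℝ 2 g) (hΔ : ∀ y, ‖y‖ ≤ 1 → Δ g y = 0)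
    (hφ : ∀ s, HasDerivAt φ (ψ s) s) (hψ : Continuous ψ)
    (h0 : ∀ s, 1 ≤ s → φ s = 0) (h0' : ∀ s, 1 ≤ s → ψ s = 0) {r : ℝ} (hr : |r| ≤ 1) :
    ∫ y, fderiv ℝ g (r • y) y * ψ (‖y‖ ^ 2) = 0 := by
  have hdc : Continuous (fderiv ℝ g) := hg.continuous_fderiv (by norm_num)
  have hddc : Continuous (fderiv ℝ (fderiv ℝ g)) :=
    (hg.fderiv_right (m := 1) (by norm_num)).continuous_fderiv (by norm_num)
  have key := integral_sum_mul_inner_mul_radial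
    (f := fun i y => fderiv ℝ g (r • y) (stdOrthonormalBasis ℝ E i))
    (v := fun i => stdOrthonormalBasis ℝ E i)
    (fun i y => hasLineDerivAt_fderiv_dilation hg r _ y _) (fun i => by fun_prop)
    (fun i => by fun_prop) hφ hψ h0 h0'
  simp_rw [← clm_eq_sum_inner, ← Finset.mul_sum, ← laplacian_eq_sum_fderiv] at key
  have hz : ∀ y : E, r * Δ g (r • y) * φ (‖y‖ ^ 2) = 0 := fun y => by
    by_cases hy : ‖y‖ ≤ 1
    · rw [hΔ (r • y) (by rw [norm_smul, Real.norm_eq_abs]; nlinarith [norm_nonneg y, abs_nonneg r])]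
      ring
    · rw [h0 _ (by nlinarith)]
      ring
  simp_rw [hz] at key
  simpa using key

/-- Mean value property with a radial weight. -/
theorem integral_mul_radial_eq (hg : ContDiff ℝ 2 g) (hΔ : ∀ y, ‖y‖ ≤ 1 → Δ g y = 0)
    (hφ : ∀ s, HasDerivAt φ (ψ s) s) (hψ : Continuous ψ)
    (h0 : ∀ s, 1 ≤ s → φ s = 0) (h0' : ∀ s, 1 ≤ s → ψ s = 0) :
    ∫ y, g y * ψ (‖y‖ ^ 2) = g 0 * ∫ y : E, ψ (‖y‖ ^ 2) := by
  have hder := fun r => hasDerivAt_integral_dilation (hg.of_le (by norm_num))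
    (F := fun _ => 1) continuous_const hψ h0' r
  simp only [mul_one] at hder
  have h := constant_of_has_deriv_right_zero (a := 0) (b := 1)
    (f := fun r : ℝ => ∫ y, g (r • y) * ψ (‖y‖ ^ 2))
    (fun r _ => (hder r).continuousAt.continuousWithinAt) (fun r hr => by
      have := (hder r).hasDerivWithinAt (s := Ici r)
      rwa [integral_fderiv_dilation_eq_zero hg hΔ hφ hψ h0 h0'
        (abs_le.2 ⟨by linarith [hr.1], hr.2.le⟩)] at this) 1 (by simp)
  simpa [integral_const_mul] using h

theorem two_mul_integral_inner_mul_inner (hφ : ∀ s, HasDerivAt φ (ψ s) s) (hψ : Continuous ψ)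
    (h0 : ∀ s, 1 ≤ s → φ s = 0) (h0' : ∀ s, 1 ≤ s → ψ s = 0) (e v : E) :
    2 * ∫ y, ⟪y, e⟫ * ⟪y, v⟫ * ψ (‖y‖ ^ 2) = ⟪v, e⟫ * (- ∫ y : E, φ (‖y‖ ^ 2)) := by
  rw [integral_mul_inner_mul_radial (f' := fun _ => ⟪v, e⟫) (fun y => hasLineDerivAt_inner e y v)
    (by fun_prop) continuous_const hφ hψ h0 h0', integral_const_mul]
  ring

theorem integral_inner_mul_radial (hφ : ∀ s, HasDerivAt φ (ψ s) s) (hψ : Continuous ψ)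
    (h0 : ∀ s, 1 ≤ s → φ s = 0) (h0' : ∀ s, 1 ≤ s → ψ s = 0) (v : E) :
    ∫ y, ⟪y, v⟫ * ψ (‖y‖ ^ 2) = 0 := by
  have h := integral_mul_inner_mul_radial (f := fun _ : E => (1 : ℝ)) (f' := fun _ => 0) (v := v)
    (fun y => by simpa using (hasFDerivAt_const (1 : ℝ) y).hasLineDerivAt v)
    continuous_const continuous_const hφ hψ h0 h0'
  simpa using h

/-- The field `y` has divergence `n`. This ties the normalisation `-∫ φ` of the derivative formula
to the mass of `ψ`. -/
theorem two_mul_integral_norm_sq (hφ : ∀ s, HasDerivAt φ (ψ s) s) (hψ : Continuous ψ)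
    (h0 : ∀ s, 1 ≤ s → φ s = 0) (h0' : ∀ s, 1 ≤ s → ψ s = 0) :
    2 * ∫ y : E, ‖y‖ ^ 2 * ψ (‖y‖ ^ 2) =
      Module.finrank ℝ E * (- ∫ y : E, φ (‖y‖ ^ 2)) := by
  have h := integral_sum_mul_inner_mul_radial
    (f := fun i (y : E) => ⟪y, stdOrthonormalBasis ℝ E i⟫) (f' := fun _ _ => 1)
    (v := fun i => stdOrthonormalBasis ℝ E i)
    (fun i y => by
      have h := hasLineDerivAt_inner (stdOrthonormalBasis ℝ E i) y (stdOrthonormalBasis ℝ E i)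
      simpa using h) (fun i => by fun_prop) (fun i => continuous_const) hφ hψ h0 h0'
  have hs : ∀ y : E, ∑ i, ⟪y, stdOrthonormalBasis ℝ E i⟫ * ⟪y, stdOrthonormalBasis ℝ E i⟫
      = ‖y‖ ^ 2 := fun y => by
    rw [← (stdOrthonormalBasis ℝ E).sum_sq_inner_left y]
    exact Finset.sum_congr rfl fun i _ => (sq _).symm
  simp_rw [hs] at h
  rw [h]
  simp [integral_const_mul]

/-- The fields `⟪y, e⟫ ∇g (r • y)` and `g (r • y) e` have divergences `∂ₑg (r • y)` and `r ∂ₑg (r •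
y)`, the first by harmonicity. Eliminating `∂ₑg` gives the Euler relation `r M' = M` for the first
moment `M`. -/
theorem integral_fderiv_dilation_mul_inner (hg : ContDiff ℝ 2 g)
    (hΔ : ∀ y, ‖y‖ ≤ 1 → Δ g y = 0)
    (hφ : ∀ s, HasDerivAt φ (ψ s) s) (hψ : Continuous ψ)
    (h0 : ∀ s, 1 ≤ s → φ s = 0) (h0' : ∀ s, 1 ≤ s → ψ s = 0) {r : ℝ} (hr : |r| ≤ 1) (e : E) :
    r * ∫ y, fderiv ℝ g (r • y) y * ⟪y, e⟫ * ψ (‖y‖ ^ 2) =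
      ∫ y, g (r • y) * ⟪y, e⟫ * ψ (‖y‖ ^ 2) := by
  have hgc := hg.continuous
  have hdc : Continuous (fderiv ℝ g) := hg.continuous_fderiv (by norm_num)
  have hddc : Continuous (fderiv ℝ (fderiv ℝ g)) :=
    (hg.fderiv_right (m := 1) (by norm_num)).continuous_fderiv (by norm_num)
  have key := integral_sum_mul_inner_mul_radial
    (f := fun i y => fderiv ℝ g (r • y) (stdOrthonormalBasis ℝ E i) * ⟪y, e⟫)
    (f' := fun i y => r * fderiv ℝ (fderiv ℝ g) (r • y) (stdOrthonormalBasis ℝ E i)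
      (stdOrthonormalBasis ℝ E i) * ⟪y, e⟫ +
      fderiv ℝ g (r • y) (stdOrthonormalBasis ℝ E i) * ⟪stdOrthonormalBasis ℝ E i, e⟫)
    (v := fun i => stdOrthonormalBasis ℝ E i)
    (fun i y => by
      have h := HasDerivAt.mul (hasLineDerivAt_fderiv_dilation hg r (stdOrthonormalBasis ℝ E i) y
        (stdOrthonormalBasis ℝ E i)) (hasLineDerivAt_inner e y (stdOrthonormalBasis ℝ E i))
      simp only [zero_smul, add_zero] at h
      exact h) (fun i => by fun_prop)
    (fun i => by fun_prop) hφ hψ h0 h0'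
  have h1 : ∀ y : E, (∑ i, fderiv ℝ g (r • y) (stdOrthonormalBasis ℝ E i) * ⟪y, e⟫ *
      ⟪y, stdOrthonormalBasis ℝ E i⟫) = fderiv ℝ g (r • y) y * ⟪y, e⟫ := fun y => by
    rw [clm_eq_sum_inner (fderiv ℝ g (r • y)) y, Finset.sum_mul]
    exact Finset.sum_congr rfl fun i _ => by ring
  have h2 : ∀ y : E, (∑ i, (r * fderiv ℝ (fderiv ℝ g) (r • y) (stdOrthonormalBasis ℝ E i)
      (stdOrthonormalBasis ℝ E i) * ⟪y, e⟫ +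
      fderiv ℝ g (r • y) (stdOrthonormalBasis ℝ E i) * ⟪stdOrthonormalBasis ℝ E i, e⟫)) *
      φ (‖y‖ ^ 2) = fderiv ℝ g (r • y) e * φ (‖y‖ ^ 2) := fun y => by
    by_cases hy : ‖y‖ ≤ 1
    · have hd := hΔ (r • y)
        (by rw [norm_smul, Real.norm_eq_abs]; nlinarith [norm_nonneg y, abs_nonneg r])
      rw [Finset.sum_add_distrib, ← Finset.sum_mul, ← Finset.mul_sum, ← laplacian_eq_sum_fderiv, hd,
        clm_eq_sum_inner (fderiv ℝ g (r • y)) e]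
      simp [real_inner_comm]
    · rw [h0 _ (by nlinarith)]
      ring
  simp_rw [h1, h2] at key
  have key2 := integral_mul_inner_mul_radial (v := e) (fun y => hasLineDerivAt_dilation (hg.differentiable (by norm_num)) r y e)
    (by fun_prop) (by fun_prop) hφ hψ h0 h0'
  simp_rw [mul_assoc r] at key2
  rw [integral_const_mul] at key2
  linear_combination r / 2 * key - key2 / 2

/-- Mean value formula for the derivative with a radial weight. -/
theorem two_mul_integral_mul_inner_mul_radial (hg : ContDiff ℝ 2 g)
    (hΔ : ∀ y, ‖y‖ ≤ 1 → Δ g y = 0)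
    (hφ : ∀ s, HasDerivAt φ (ψ s) s) (hψ : Continuous ψ)
    (h0 : ∀ s, 1 ≤ s → φ s = 0) (h0' : ∀ s, 1 ≤ s → ψ s = 0) (e : E) :
    2 * ∫ y, g y * ⟪y, e⟫ * ψ (‖y‖ ^ 2) = fderiv ℝ g 0 e * (- ∫ y : E, φ (‖y‖ ^ 2)) := by
  have hder := fun r => hasDerivAt_integral_dilation (hg.of_le (by norm_num))
    (F := fun y => ⟪y, e⟫) (by fun_prop) hψ h0' r
  have hM := fun (r : ℝ) (hr : |r| ≤ 1) =>
    integral_fderiv_dilation_mul_inner hg hΔ hφ hψ h0 h0' hr e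
  set M : ℝ → ℝ := fun r => ∫ y, g (r • y) * ⟪y, e⟫ * ψ (‖y‖ ^ 2) with hMdef
  set M' : ℝ → ℝ := fun r => ∫ y, fderiv ℝ g (r • y) y * ⟪y, e⟫ * ψ (‖y‖ ^ 2) with hM'def
  have hM' : ∀ r : ℝ, |r| ≤ 1 → r * M' r = M r := hM
  -- By `r M' = M` the quotient `M r / r` is constant; its limit at `0⁺` is `M' 0`, where the
  -- derivative of `g` is frozen at the origin.
  have hconst : ∀ r, 0 < r → r ≤ 1 → M 1 = M r / r := fun r hr0 hr1 => by
    have h := constant_of_has_deriv_right_zero (a := r) (b := 1) (f := fun t => M t / t)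
      (fun t ht => ((hder t).continuousAt.div continuousAt_id
        (by simp; linarith [ht.1])).continuousWithinAt) (fun t ht => by
        have ht0 : t ≠ 0 := by linarith [ht.1]
        have := ((hder t).div (hasDerivAt_id t) ht0).hasDerivWithinAt (s := Ici t)
        refine this.congr_deriv ?_
        have h2 : t * M' t = M t := hM' t (abs_le.2 ⟨by linarith [ht.1], ht.2.le⟩)
        change (M' t * t - M t * 1) / t ^ 2 = 0
        rw [← h2]
        ring) 1 ⟨hr1, le_rfl⟩
    simpa using h
  have hM0 : M 0 = 0 := by rw [← hM' 0 (by simp), zero_mul]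
  have hlim : Tendsto (fun r => M r / r) (𝓝[>] 0) (𝓝 (M' 0)) := by
    have h := (hder 0).tendsto_slope_zero_right
    refine h.congr fun t => ?_
    change t⁻¹ • (M (0 + t) - M 0) = _
    rw [hM0, zero_add, sub_zero, smul_eq_mul]
    ring
  have hlim2 : Tendsto (fun r => M r / r) (𝓝[>] 0) (𝓝 (M 1)) := by
    refine tendsto_const_nhds.congr' ?_
    filter_upwards [Ioc_mem_nhdsGT (zero_lt_one' ℝ)] with r hr using hconst r hr.1 hr.2
  have h1 : M 1 = M' 0 := tendsto_nhds_unique hlim2 hlim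
  have h2 : ∀ y, fderiv ℝ g 0 y = ⟪y, gradient g 0⟫ := fun y => by
    rw [gradient, real_inner_comm, InnerProductSpace.toDual_symm_apply]
  simp only [hMdef, hM'def, one_smul, zero_smul, h2] at h1
  rw [h1, h2, two_mul_integral_inner_mul_inner (e := gradient g 0) (v := e) hφ hψ h0 h0' |>.symm]

end MeanValue

/-! ### The one-variable certificate. -/

/-- The potential certifying that the average of `|y₁ + a|` over the unit sphere of dimension `2`
equals `(1 + a ^ 2) / 2`. -/
theorem exists_cap_potential {a : ℝ} (ha : |a| < 1) :
    ∃ k k' : ℝ → ℝ, (∀ y, HasDerivAt k (k' y) y) ∧ Continuous k' ∧ (∀ y, 0 ≤ k' y) ∧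
      (∀ y, |y| ≤ 1 → (1 - |a|) ^ 2 / 8 ≤ k' y) ∧
      ∀ y, |y + a| = (1 + a ^ 2) / 2 + 2 * (k y * y) - (1 - y ^ 2) * k' y := by
  have ha1 : -1 < a := (abs_lt.1 ha).1
  have ha2 : a < 1 := (abs_lt.1 ha).2
  -- The identity reads `((1 - y²) k)' = (1 + a²) / 2 - |y + a|`. Integrating from `1` gives `k₁`,
  -- from `-1` gives `k₂`; the mean value `(1 + a²) / 2` is what makes them agree at `-a`.
  let k₁ : ℝ → ℝ := fun y => 1 / 2 - (1 - a) ^ 2 / 2 * (1 + y)⁻¹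
  let k₂ : ℝ → ℝ := fun y => -1 / 2 + (1 + a) ^ 2 / 2 * (1 - y)⁻¹
  let d₁ : ℝ → ℝ := fun y => (1 - a) ^ 2 / 2 * ((1 + y) ^ 2)⁻¹
  let d₂ : ℝ → ℝ := fun y => (1 + a) ^ 2 / 2 * ((1 - y) ^ 2)⁻¹
  let k : ℝ → ℝ := fun y => if -a ≤ y then k₁ y else k₂ y
  let k' : ℝ → ℝ := fun y => if -a ≤ y then d₁ y else d₂ y
  have h1 : ∀ y, -a ≤ y → 0 < 1 + y := fun y hy => by linarith
  have h2 : ∀ y, y ≤ -a → 0 < 1 - y := fun y hy => by linarith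
  have hne1 : (1 + -a : ℝ) ≠ 0 := (h1 _ le_rfl).ne'
  have hne2 : (1 - -a : ℝ) ≠ 0 := (h2 _ le_rfl).ne'
  have hka : k₁ (-a) = k₂ (-a) := by
    simp only [k₁, k₂]
    field_simp
    ring
  have hda : d₁ (-a) = d₂ (-a) := by
    simp only [d₁, d₂]
    field_simp
    ring
  have hk1 : ∀ y, -a ≤ y → k y = k₁ y := fun y hy => if_pos hy
  have hd1 : ∀ y, -a ≤ y → k' y = d₁ y := fun y hy => if_pos hy
  have hk2 : ∀ y, y ≤ -a → k y = k₂ y := fun y hy => by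
    rcases hy.eq_or_lt with rfl | hy
    · rw [hk1 _ le_rfl, hka]
    · exact if_neg (not_le.2 hy)
  have hd2 : ∀ y, y ≤ -a → k' y = d₂ y := fun y hy => by
    rcases hy.eq_or_lt with rfl | hy
    · rw [hd1 _ le_rfl, hda]
    · exact if_neg (not_le.2 hy)
  have hr : ∀ y, -a ≤ y → HasDerivWithinAt k (k' y) (Ici (-a)) y := fun y hy => by
    have h := ((((hasDerivAt_id y).const_add 1).inv (h1 y hy).ne').const_mul
      ((1 - a) ^ 2 / 2)).const_sub (1 / 2)
    refine (h.hasDerivWithinAt.congr (fun z hz => hk1 z hz) (hk1 y hy)).congr_deriv ?_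
    rw [hd1 y hy]
    simp only [d₁, id]
    ring
  have hl : ∀ y, y ≤ -a → HasDerivWithinAt k (k' y) (Iic (-a)) y := fun y hy => by
    have h := ((((hasDerivAt_id y).const_sub 1).inv (h2 y hy).ne').const_mul
      ((1 + a) ^ 2 / 2)).const_add (-1 / 2)
    refine (h.hasDerivWithinAt.congr (fun z hz => hk2 z hz) (hk2 y hy)).congr_deriv ?_
    rw [hd2 y hy]
    simp only [d₂, id]
    ring
  have hsq1 : ((1 - |a|) ^ 2 : ℝ) ≤ (1 - a) ^ 2 := by
    have := le_abs_self a
    nlinarith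
  have hsq2 : ((1 - |a|) ^ 2 : ℝ) ≤ (1 + a) ^ 2 := by
    have := neg_abs_le a
    nlinarith
  refine ⟨k, k', fun y => ?_, ?_, fun y => ?_, fun y hy => ?_, fun y => ?_⟩
  · rcases lt_trichotomy y (-a) with hy | rfl | hy
    · exact (hl y hy.le).hasDerivAt (Iic_mem_nhds hy)
    · have h := (hl _ le_rfl).union (hr _ le_rfl)
      rwa [Iic_union_Ici, hasDerivWithinAt_univ] at h
    · exact (hr y hy.le).hasDerivAt (Ici_mem_nhds hy)
  · refine continuous_if_le continuous_const continuous_id ?_ ?_ fun y hy => ?_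
    · refine continuousOn_const.mul (ContinuousOn.inv₀ (by fun_prop) fun y hy => ?_)
      exact (pow_pos (h1 y hy) 2).ne'
    · refine continuousOn_const.mul (ContinuousOn.inv₀ (by fun_prop) fun y hy => ?_)
      exact (pow_pos (h2 y hy) 2).ne'
    · obtain rfl : -a = y := hy
      exact hda
  · rcases le_total (-a) y with h | h
    · rw [hd1 y h]; positivity
    · rw [hd2 y h]; positivity
  · obtain ⟨hy1, hy2⟩ := abs_le.1 hy
    rcases le_total (-a) y with h | h
    · rw [hd1 y h]
      have hp := h1 y h
      change _ ≤ (1 - a) ^ 2 / 2 * ((1 + y) ^ 2)⁻¹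
      rw [← div_eq_mul_inv, div_div, div_le_div_iff₀ (by norm_num) (by positivity)]
      have : (1 + y) ^ 2 ≤ 4 := by nlinarith
      nlinarith [mul_le_mul hsq1 this (sq_nonneg _) (sq_nonneg _)]
    · rw [hd2 y h]
      have hp := h2 y h
      change _ ≤ (1 + a) ^ 2 / 2 * ((1 - y) ^ 2)⁻¹
      rw [← div_eq_mul_inv, div_div, div_le_div_iff₀ (by norm_num) (by positivity)]
      have : (1 - y) ^ 2 ≤ 4 := by nlinarith
      nlinarith [mul_le_mul hsq2 this (sq_nonneg _) (sq_nonneg _)]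
  · rcases le_total (-a) y with h | h
    · rw [hd1 y h, hk1 y h, abs_of_nonneg (by linarith)]
      have hp := (h1 y h).ne'
      simp only [k₁, d₁]
      field_simp
      ring
    · rw [hd2 y h, hk2 y h, abs_of_nonpos (by linarith)]
      have hp := (h2 y h).ne'
      simp only [k₂, d₂]
      field_simp
      ring

/-- A function with derivative at least `c` on `[-1, 1]` grows at least linearly from `0`. -/
theorem mul_self_le_of_le_deriv {k k' : ℝ → ℝ} {c : ℝ} (hk : ∀ y, HasDerivAt k (k' y) y)
    (hc : ∀ y, |y| ≤ 1 → c ≤ k' y) {y : ℝ} (hy : |y| ≤ 1) :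
    k 0 * y + c * y ^ 2 ≤ k y * y := by
  have hmono : MonotoneOn (fun y => k y - c * y) (Icc (-1) 1) := by
    have hd : ∀ y, HasDerivAt (fun y => k y - c * y) (k' y - c * 1) y := fun y =>
      (hk y).sub ((hasDerivAt_id y).const_mul c)
    refine monotoneOn_of_deriv_nonneg (convex_Icc _ _)
      (fun y _ => (hd y).continuousAt.continuousWithinAt)
      (fun y _ => (hd y).differentiableAt.differentiableWithinAt) fun y hy => ?_
    rw [interior_Icc] at hy
    rw [(hd y).deriv, mul_one, sub_nonneg]
    exact hc y (abs_le.2 ⟨hy.1.le, hy.2.le⟩)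
  have hy' := abs_le.1 hy
  rcases le_total 0 y with h | h
  · have := hmono ⟨by norm_num, by norm_num⟩ ⟨hy'.1, hy'.2⟩ h
    simp only [mul_zero, sub_zero] at this
    nlinarith
  · have := hmono ⟨hy'.1, hy'.2⟩ ⟨by norm_num, by norm_num⟩ h
    simp only [mul_zero, sub_zero] at this
    nlinarith

/-! ### The estimate at the centre. -/

section Certificate

variable {E : Type*} [NormedAddCommGroup E] [InnerProductSpace ℝ E] [FiniteDimensional ℝ E]
  [MeasurableSpace E] [BorelSpace E]

/-- Integration by parts on spheres for zonal functions. -/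
theorem integral_zonal_eq_zero {k k' ψ ψ' : ℝ → ℝ} (hk : ∀ y, HasDerivAt k (k' y) y)
    (hk' : Continuous k') (hψ : ∀ s, HasDerivAt ψ (ψ' s) s) (hψ' : Continuous ψ')
    (h0 : ∀ s, 1 ≤ s → ψ s = 0) (h0' : ∀ s, 1 ≤ s → ψ' s = 0) {e : E} (he : ‖e‖ = 1) :
    ∫ y : E, ((Module.finrank ℝ E - 1) * (k ⟪y, e⟫ * ⟪y, e⟫) -
      (‖y‖ ^ 2 - ⟪y, e⟫ ^ 2) * k' ⟪y, e⟫) * ψ (‖y‖ ^ 2) = 0 := by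
  have hkc : Continuous k := continuous_iff_continuousAt.2 fun s => (hk s).continuousAt
  have hψc : Continuous ψ := continuous_iff_continuousAt.2 fun s => (hψ s).continuousAt
  have hkl : ∀ y v : E, HasLineDerivAt ℝ (fun y => k ⟪y, e⟫) (k' ⟪y, e⟫ * ⟪v, e⟫) y v :=
    fun y v => by
      have h := hasLineDerivAt_inner e y v
      have hk0 := hk ⟪y + (0 : ℝ) • v, e⟫
      have h2 := HasDerivAt.comp (0 : ℝ) hk0 h
      simp only [zero_smul, add_zero] at h2
      exact h2
  have hn : ∀ y v : E, HasLineDerivAt ℝ (fun y => ‖y‖ ^ 2) (2 * ⟪y, v⟫) y v := fun y v => by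
    have h := hasLineDerivAt_radial (fun s => hasDerivAt_id s) y v
    simpa using h
  have key := integral_sum_mul_inner_mul_radial
    (f := fun i (y : E) => k ⟪y, e⟫ * ⟪y, e⟫ * ⟪y, stdOrthonormalBasis ℝ E i⟫)
    (f' := fun i y => (k' ⟪y, e⟫ * ⟪stdOrthonormalBasis ℝ E i, e⟫ * ⟪y, e⟫ +
      k ⟪y, e⟫ * ⟪stdOrthonormalBasis ℝ E i, e⟫) * ⟪y, stdOrthonormalBasis ℝ E i⟫ +
      k ⟪y, e⟫ * ⟪y, e⟫ * 1)
    (v := fun i => stdOrthonormalBasis ℝ E i)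
    (fun i y => by
      have h1 := hasLineDerivAt_inner (stdOrthonormalBasis ℝ E i) y (stdOrthonormalBasis ℝ E i)
      rw [real_inner_self_eq_norm_sq, (stdOrthonormalBasis ℝ E).norm_eq_one, one_pow] at h1
      have h := HasDerivAt.mul (HasDerivAt.mul (hkl y (stdOrthonormalBasis ℝ E i))
        (hasLineDerivAt_inner e y (stdOrthonormalBasis ℝ E i))) h1
      simp only [zero_smul, add_zero, Pi.mul_apply] at h
      exact h) (fun i => by fun_prop) (fun i => by fun_prop) hψ hψ' h0 h0'
  have hs1 : ∀ y : E, (∑ i, k ⟪y, e⟫ * ⟪y, e⟫ * ⟪y, stdOrthonormalBasis ℝ E i⟫ *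
      ⟪y, stdOrthonormalBasis ℝ E i⟫) = k ⟪y, e⟫ * ‖y‖ ^ 2 * ⟪y, e⟫ := fun y => by
    rw [← (stdOrthonormalBasis ℝ E).sum_sq_inner_left y, Finset.mul_sum, Finset.sum_mul]
    exact Finset.sum_congr rfl fun i _ => by ring
  have hs2 : ∀ y : E, (∑ i, ((k' ⟪y, e⟫ * ⟪stdOrthonormalBasis ℝ E i, e⟫ * ⟪y, e⟫ +
      k ⟪y, e⟫ * ⟪stdOrthonormalBasis ℝ E i, e⟫) * ⟪y, stdOrthonormalBasis ℝ E i⟫ +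
      k ⟪y, e⟫ * ⟪y, e⟫ * 1)) =
      k' ⟪y, e⟫ * ⟪y, e⟫ ^ 2 + (Module.finrank ℝ E + 1) * (k ⟪y, e⟫ * ⟪y, e⟫) := fun y => by
    have hin : ∑ i, ⟪y, stdOrthonormalBasis ℝ E i⟫ * ⟪stdOrthonormalBasis ℝ E i, e⟫ = ⟪y, e⟫ :=
      (stdOrthonormalBasis ℝ E).sum_inner_mul_inner y e
    rw [Finset.sum_add_distrib]
    have : ∀ i, (k' ⟪y, e⟫ * ⟪stdOrthonormalBasis ℝ E i, e⟫ * ⟪y, e⟫ +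
      k ⟪y, e⟫ * ⟪stdOrthonormalBasis ℝ E i, e⟫) * ⟪y, stdOrthonormalBasis ℝ E i⟫ =
      (k' ⟪y, e⟫ * ⟪y, e⟫ + k ⟪y, e⟫) *
        (⟪y, stdOrthonormalBasis ℝ E i⟫ * ⟪stdOrthonormalBasis ℝ E i, e⟫) := fun i => by ring
    simp_rw [this, ← Finset.mul_sum, hin]
    simp
    ring
  simp_rw [hs1, hs2] at key
  -- The fields `k ⟪y, e⟫ y` and `k ‖y‖² e` have the same inner product with `y`: their difference
  -- is tangent to spheres. Hence their divergences have equal weighted integrals.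
  have key2 := integral_mul_inner_mul_radial (v := e) (f := fun y : E => k ⟪y, e⟫ * ‖y‖ ^ 2)
    (f' := fun y => k' ⟪y, e⟫ * ‖y‖ ^ 2 + k ⟪y, e⟫ * (2 * ⟪y, e⟫))
    (fun y => by
      have h1 := hkl y e
      rw [real_inner_self_eq_norm_sq, he, one_pow, mul_one] at h1
      have h := HasDerivAt.mul h1 (hn y e)
      simp only [zero_smul, add_zero] at h
      exact h) (by fun_prop) (by fun_prop) hψ hψ' h0 h0'
  rw [key] at key2
  have key3 := neg_injective key2
  rw [← sub_eq_zero, ← integral_sub] at key3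
  · rw [← key3]
    congr 1 with y
    ring
  · exact integrable_mul_radial (F := fun y : E => k' ⟪y, e⟫ * ⟪y, e⟫ ^ 2 +
      (Module.finrank ℝ E + 1) * (k ⟪y, e⟫ * ⟪y, e⟫)) (by fun_prop) hψc h0
  · exact integrable_mul_radial (F := fun y : E => k' ⟪y, e⟫ * ‖y‖ ^ 2 + k ⟪y, e⟫ * (2 * ⟪y, e⟫))
      (by fun_prop) hψc h0

/-- Schwarz–Pick type estimate at the centre, for functions smooth on the whole space. -/
theorem mul_fderiv_zero_add_le {g : E → ℝ} (hn : 3 ≤ Module.finrank ℝ E) (hg : ContDiff ℝ 2 g)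
    (hΔ : ∀ y, ‖y‖ ≤ 1 → Δ g y = 0) (hbd : ∀ y, ‖y‖ ≤ 1 → |g y| ≤ 1) (h1 : |g 0| < 1)
    {e : E} (he : ‖e‖ = 1) {κ : ℝ} (hκ0 : 0 < κ) (hκ : κ < 1) :
    κ * (fderiv ℝ g 0 e + (Module.finrank ℝ E - 3) * ((1 - |g 0|) ^ 2 / 8)) ≤
      Module.finrank ℝ E / 2 * (1 - g 0 ^ 2) := by
  obtain ⟨φ, ψ, ψ', hφ, hψ, hψ', hφ0, hψ0, hψ0', hpos, hsupp, s, hs, hψs⟩ :=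
    exists_radial_weight hκ0 hκ
  obtain ⟨k, k', hk, hk', hk'0, hk'c, hkeq⟩ := exists_cap_potential h1
  have hψc : Continuous ψ := continuous_iff_continuousAt.2 fun s => (hψ s).continuousAt
  have hkc : Continuous k := continuous_iff_continuousAt.2 fun s => (hk s).continuousAt
  have hgc := hg.continuous
  have hn' : (3 : ℝ) ≤ Module.finrank ℝ E := by exact_mod_cast hn
  have e1 := integral_mul_radial_eq hg hΔ hφ hψc hφ0 hψ0
  have e2 := two_mul_integral_mul_inner_mul_radial hg hΔ hφ hψc hφ0 hψ0 e
  have e3 := two_mul_integral_norm_sq (E := E) hφ hψc hφ0 hψ0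
  have e4 := two_mul_integral_inner_mul_inner hφ hψc hφ0 hψ0 e e
  have e5 := integral_inner_mul_radial hφ hψc hφ0 hψ0 e
  have e6 := integral_zonal_eq_zero hk hk' hψ hψ' hψ0 hψ0' he
  rw [real_inner_self_eq_norm_sq, he, one_pow, one_mul] at e4
  set a := g 0
  set c := (1 - |a|) ^ 2 / 8
  set n : ℝ := ((Module.finrank ℝ E : ℕ) : ℝ)
  set Φ := -∫ y : E, φ (‖y‖ ^ 2)
  set S := ∫ y : E, ψ (‖y‖ ^ 2) with hS
  set D := fderiv ℝ g 0 e
  have i0 : Integrable (fun y : E => ψ (‖y‖ ^ 2)) := by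
    simpa using integrable_mul_radial (E := E) (F := fun _ => 1) continuous_const hψc hψ0
  have i1 := integrable_mul_radial hgc hψc hψ0
  have i2 := integrable_mul_radial (F := fun y => g y * ⟪y, e⟫) (by fun_prop) hψc hψ0
  have i3 := integrable_mul_radial (E := E) (F := fun y => ‖y‖ ^ 2) (by fun_prop) hψc hψ0
  have i4 := integrable_mul_radial (F := fun y => ⟪y, e⟫ * ⟪y, e⟫) (by fun_prop) hψc hψ0
  have i5 := integrable_mul_radial (F := fun y => ⟪y, e⟫) (by fun_prop) hψc hψ0
  have i6 := integrable_mul_radial (F := fun y => (n - 1) * (k ⟪y, e⟫ * ⟪y, e⟫) -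
      (‖y‖ ^ 2 - ⟪y, e⟫ ^ 2) * k' ⟪y, e⟫) (by fun_prop) hψc hψ0
  have hSpos : 0 < S := by
    rw [hS, integral_pos_iff_support_of_nonneg (fun y => hpos _) i0]
    refine IsOpen.measure_pos _ ?_ ⟨√s • e, ?_⟩
    · exact (hψc.comp (by fun_prop : Continuous fun y : E => ‖y‖ ^ 2)).isOpen_support
    · rw [Function.mem_support, norm_smul, he, mul_one, Real.norm_of_nonneg (Real.sqrt_nonneg s),
        Real.sq_sqrt hs.le]
      exact hψs.ne'
  have hQ : κ * S ≤ ∫ y : E, ‖y‖ ^ 2 * ψ (‖y‖ ^ 2) := by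
    rw [hS, ← integral_const_mul]
    refine integral_mono (i0.const_mul κ) i3 fun y => ?_
    rcases le_total (‖y‖ ^ 2) κ with h | h
    · simp [hsupp _ h]
    · exact mul_le_mul_of_nonneg_right h (hpos _)
  have hmain : (∫ y, g y * ⟪y, e⟫ * ψ (‖y‖ ^ 2)) + a * ∫ y, g y * ψ (‖y‖ ^ 2) ≤
      (1 + a ^ 2) / 2 * S + (∫ y : E, ((n - 1) * (k ⟪y, e⟫ * ⟪y, e⟫) -
      (‖y‖ ^ 2 - ⟪y, e⟫ ^ 2) * k' ⟪y, e⟫) * ψ (‖y‖ ^ 2)) -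
      (n - 3) * k 0 * (∫ y, ⟪y, e⟫ * ψ (‖y‖ ^ 2)) -
      (n - 3) * c * (∫ y, ⟪y, e⟫ * ⟪y, e⟫ * ψ (‖y‖ ^ 2)) := by
    have iA : Integrable (fun y : E => (1 + a ^ 2) / 2 * ψ (‖y‖ ^ 2) +
        ((n - 1) * (k ⟪y, e⟫ * ⟪y, e⟫) - (‖y‖ ^ 2 - ⟪y, e⟫ ^ 2) * k' ⟪y, e⟫) * ψ (‖y‖ ^ 2)) :=
      (i0.const_mul _).add i6
    have iB : Integrable (fun y : E => (1 + a ^ 2) / 2 * ψ (‖y‖ ^ 2) +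
        ((n - 1) * (k ⟪y, e⟫ * ⟪y, e⟫) - (‖y‖ ^ 2 - ⟪y, e⟫ ^ 2) * k' ⟪y, e⟫) * ψ (‖y‖ ^ 2) -
        (n - 3) * k 0 * (⟪y, e⟫ * ψ (‖y‖ ^ 2))) := iA.sub (i5.const_mul _)
    simp only [hS, ← integral_const_mul]
    rw [← integral_add i2 (i1.const_mul a), ← integral_add (i0.const_mul _) i6,
      ← integral_sub iA (i5.const_mul _), ← integral_sub iB (i4.const_mul _)]
    refine integral_mono (i2.add (i1.const_mul a)) (iB.sub (i4.const_mul _)) fun y => ?_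
    beta_reduce
    by_cases hy : ‖y‖ ≤ 1
    · have hyn := norm_nonneg y
      have hye : |⟪y, e⟫| ≤ 1 := by
        have := abs_real_inner_le_norm y e
        rw [he, mul_one] at this
        linarith
      have b1 : g y * (⟪y, e⟫ + a) ≤ |⟪y, e⟫ + a| := by
        refine (le_abs_self _).trans ?_
        rw [abs_mul]
        exact mul_le_of_le_one_left (abs_nonneg _) (hbd y hy)
      have b2 := mul_self_le_of_le_deriv hk hk'c hye
      -- Allows `1 - ⟪y, e⟫²` in the potential to be replaced by `‖y‖² - ⟪y, e⟫²`, the form that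
      -- integrates to zero.
      have b3 : 0 ≤ (1 - ‖y‖ ^ 2) * k' ⟪y, e⟫ := mul_nonneg (by nlinarith) (hk'0 _)
      have b4 := mul_le_mul_of_nonneg_left b2 (sub_nonneg.2 hn')
      rw [hkeq] at b1
      have b5 : g y * (⟪y, e⟫ + a) ≤ (1 + a ^ 2) / 2 + ((n - 1) * (k ⟪y, e⟫ * ⟪y, e⟫) -
          (‖y‖ ^ 2 - ⟪y, e⟫ ^ 2) * k' ⟪y, e⟫) - (n - 3) * k 0 * ⟪y, e⟫ -
          (n - 3) * c * (⟪y, e⟫ * ⟪y, e⟫) := by linarith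
      have b6 := mul_le_mul_of_nonneg_right b5 (hpos (‖y‖ ^ 2))
      linarith
    · rw [hψ0 _ (by nlinarith)]
      simp
  rw [e1, e5, e6, eq_div_of_mul_eq two_ne_zero ((mul_comm _ _).trans e2),
    eq_div_of_mul_eq two_ne_zero ((mul_comm _ _).trans e4)] at hmain
  have hΦ : Φ * (D + (n - 3) * c) ≤ (1 - a ^ 2) * S := by linarith
  have ha2 : 0 < 1 - a ^ 2 := by
    rw [← sq_abs]
    nlinarith [abs_nonneg a]
  -- Comparing `κ S` with `n / 2 * Φ` inside the product needs the other factor nonnegative;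
  -- otherwise the claim is trivial.
  by_cases hD : D + (n - 3) * c ≤ 0
  · have : κ * (D + (n - 3) * c) ≤ 0 := mul_nonpos_of_nonneg_of_nonpos hκ0.le hD
    have : 0 ≤ n / 2 * (1 - a ^ 2) := by positivity
    linarith
  · push Not at hD
    have hκΦ : κ * S ≤ n / 2 * Φ := by linarith
    have h3 := mul_le_mul_of_nonneg_right hκΦ hD.le
    have h4 := mul_le_mul_of_nonneg_left hΦ (show 0 ≤ n / 2 by positivity)
    refine le_of_mul_le_mul_right ?_ hSpos
    linarith

end Certificate

/-! ### Rescaling to an arbitrary point. -/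

theorem fderiv_comp_add_smul {E F : Type*} [NormedAddCommGroup E] [NormedSpace ℝ E]
    [NormedAddCommGroup F] [NormedSpace ℝ F] (f : E → F) (x : E) (r : ℝ) :
    fderiv ℝ (fun y => f (x + r • y)) = fun y => r • fderiv ℝ f (x + r • y) := by
  ext1 y
  have h := fderiv_comp_smul (f := fun z => f (x + z)) (x := y) r
  rw [h, fderiv_comp_add_left]

section Dilation

variable {E : Type*} [NormedAddCommGroup E] [InnerProductSpace ℝ E] [FiniteDimensional ℝ E]

theorem laplacian_comp_add_smul {f : E → ℝ} {x : E} {r : ℝ} {y : E}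
    (hf : ContDiffAt ℝ 2 f (x + r • y)) :
    Δ (fun y => f (x + r • y)) y = r ^ 2 * Δ f (x + r • y) := by
  have hd : DifferentiableAt ℝ (fderiv ℝ f) (x + r • y) :=
    (hf.fderiv_right (m := 1) (by norm_num)).differentiableAt (by norm_num)
  have hd' : DifferentiableAt ℝ (fun y => fderiv ℝ f (x + r • y)) y :=
    DifferentiableAt.comp y hd (by fun_prop)
  rw [laplacian_eq_sum_fderiv, laplacian_eq_sum_fderiv, fderiv_comp_add_smul,
    fderiv_fun_const_smul hd', fderiv_comp_add_smul, Finset.mul_sum]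
  refine Finset.sum_congr rfl fun i _ => ?_
  simp
  ring

/-- A function harmonic on a ball of radius larger than `1` agrees near the closed unit ball with
a function of class `C²` on the whole space. -/
theorem exists_contDiff_eventuallyEq {f : E → ℝ} {R : ℝ} (hR : 1 < R)
    (hf : ∀ y, ‖y‖ < R → ContDiffAt ℝ 2 f y) :
    ∃ g : E → ℝ, ContDiff ℝ 2 g ∧ ∀ y, ‖y‖ ≤ 1 → g =ᶠ[𝓝 y] f := by
  let χ : ContDiffBump (0 : E) :=
    ⟨(2 + R) / 3, (1 + 2 * R) / 3, by linarith, by linarith⟩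
  refine ⟨fun y => χ y * f y, contDiff_iff_contDiffAt.2 fun y => ?_, fun y hy => ?_⟩
  · by_cases hy : ‖y‖ < R
    · exact χ.contDiffAt.mul (hf y hy)
    · have h : (fun y => χ y * f y) =ᶠ[𝓝 y] fun _ => 0 := by
        have hlt : (1 + 2 * R) / 3 < ‖y‖ := by linarith
        filter_upwards [continuous_norm.continuousAt.eventually (lt_mem_nhds hlt)] with z hz
        rw [χ.zero_of_le_dist (by rw [dist_zero_right]; exact le_of_lt hz), zero_mul]
      exact contDiffAt_const.congr_of_eventuallyEq h
  · have hlt : ‖y‖ < (2 + R) / 3 := by linarith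
    filter_upwards [continuous_norm.continuousAt.eventually (gt_mem_nhds hlt)] with z hz
    rw [χ.one_of_mem_closedBall (by rw [mem_closedBall_zero_iff]; exact le_of_lt hz), one_mul]

variable [MeasurableSpace E] [BorelSpace E]

/-- Schwarz–Pick type estimate for directional derivatives of harmonic functions on the unit
ball. -/
theorem one_sub_norm_mul_fderiv_add_le {h : E → ℝ} (hn : 3 ≤ Module.finrank ℝ E)
    (hharm : InnerProductSpace.HarmonicOnNhd h (ball 0 1))
    (hmaps : MapsTo h (ball 0 1) (Ioo (-1) 1)) {x : E} (hx : x ∈ ball 0 1) {e : E}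
    (he : ‖e‖ = 1) :
    (1 - ‖x‖) * fderiv ℝ h x e + (Module.finrank ℝ E - 3) * ((1 - |h x|) ^ 2 / 8) ≤
      Module.finrank ℝ E / 2 * (1 - h x ^ 2) := by
  have hx1 : ‖x‖ < 1 := by simpa using hx
  -- One `ρ` serves twice: it shrinks the ball about `x`, leaving room for a `C²` extension past the
  -- closed unit ball, and it is the cutoff `κ` of the weight.
  have key : ∀ ρ ∈ Ioo (0 : ℝ) 1,
      ρ * (ρ * (1 - ‖x‖) * fderiv ℝ h x e + (Module.finrank ℝ E - 3) * ((1 - |h x|) ^ 2 / 8)) ≤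
      Module.finrank ℝ E / 2 * (1 - h x ^ 2) := by
    intro ρ hρ
    have hr0 : 0 < ρ * (1 - ‖x‖) := mul_pos hρ.1 (by linarith)
    have hmem : ∀ y : E, ‖y‖ < ρ⁻¹ → x + (ρ * (1 - ‖x‖)) • y ∈ ball (0 : E) 1 := by
      intro y hy
      rw [mem_ball_zero_iff]
      refine (norm_add_le _ _).trans_lt ?_
      rw [norm_smul, Real.norm_of_nonneg hr0.le]
      have h1 : ρ * ‖y‖ < 1 := by
        have := mul_lt_mul_of_pos_left hy hρ.1
        rwa [mul_inv_cancel₀ hρ.1.ne'] at this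
      nlinarith
    have hR : 1 < ρ⁻¹ := (one_lt_inv₀ hρ.1).2 hρ.2
    obtain ⟨g, hg, hgf⟩ := exists_contDiff_eventuallyEq
      (f := fun y => h (x + (ρ * (1 - ‖x‖)) • y)) hR fun y hy =>
        ContDiffAt.comp y (hharm _ (hmem y hy)).1 (by fun_prop)
    have hg0 : g 0 = h x := by simpa using (hgf 0 (by simp)).eq_of_nhds
    have hd0 : fderiv ℝ g 0 = (ρ * (1 - ‖x‖)) • fderiv ℝ h x := by
      rw [(hgf 0 (by simp)).fderiv_eq, fderiv_comp_add_smul]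
      simp
    have hb : ∀ y : E, ‖y‖ ≤ 1 → |g y| < 1 := fun y hy => by
      rw [(hgf y hy).eq_of_nhds]
      exact abs_lt.2 (hmaps (hmem y (hy.trans_lt hR)))
    have hmn := mul_fderiv_zero_add_le hn hg (fun y hy => by
      rw [(InnerProductSpace.laplacian_congr_nhds (hgf y hy)).eq_of_nhds,
        laplacian_comp_add_smul (hharm _ (hmem y (hy.trans_lt hR))).1,
        (hharm _ (hmem y (hy.trans_lt hR))).2.eq_of_nhds]
      simp) (fun y hy => (hb y hy).le) (hb 0 (by simp)) he hρ.1 hρ.2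
    rwa [hg0, hd0, smul_apply, smul_eq_mul] at hmn
  have hc : Continuous fun ρ : ℝ => ρ * (ρ * (1 - ‖x‖) * fderiv ℝ h x e +
      (Module.finrank ℝ E - 3) * ((1 - |h x|) ^ 2 / 8)) := by fun_prop
  have hlim := (hc.tendsto 1).mono_left (nhdsWithin_le_nhds (s := Iio 1))
  have := le_of_tendsto hlim (by
    filter_upwards [Ioo_mem_nhdsLT (zero_lt_one' ℝ)] with ρ hρ using key ρ hρ)
  simpa using this

theorem one_sub_norm_mul_norm_gradient_add_le {h : E → ℝ} (hn : 3 ≤ Module.finrank ℝ E)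
    (hharm : InnerProductSpace.HarmonicOnNhd h (ball 0 1))
    (hmaps : MapsTo h (ball 0 1) (Ioo (-1) 1)) {x : E} (hx : x ∈ ball 0 1) :
    (1 - ‖x‖) * ‖gradient h x‖ + (Module.finrank ℝ E - 3) * ((1 - |h x|) ^ 2 / 8) ≤
      Module.finrank ℝ E / 2 * (1 - h x ^ 2) := by
  have hin : ∀ y, fderiv ℝ h x y = ⟪gradient h x, y⟫ := fun y => by
    rw [gradient, InnerProductSpace.toDual_symm_apply]
  -- With zero gradient there is no direction to normalise, but the `n - 3` term still has to be
  -- bounded; any unit vector does.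
  by_cases h0 : gradient h x = 0
  · have : Nontrivial E := Module.nontrivial_of_finrank_pos (R := ℝ) (by omega)
    obtain ⟨e, he⟩ := exists_norm_eq E (zero_le_one' ℝ)
    have := one_sub_norm_mul_fderiv_add_le hn hharm hmaps hx he
    rw [hin, h0, inner_zero_left] at this
    rwa [h0, norm_zero]
  · have hpos : 0 < ‖gradient h x‖ := norm_pos_iff.2 h0
    have := one_sub_norm_mul_fderiv_add_le hn hharm hmaps hx
      (e := ‖gradient h x‖⁻¹ • gradient h x) (norm_smul_inv_norm h0)
    rwa [hin, real_inner_smul_right, real_inner_self_eq_norm_sq, sq,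
      inv_mul_cancel_left₀ hpos.ne'] at this

end Dilation

theorem mainTheorem6 (n : ℕ) (hn : 3 ≤ n) (h : EuclideanSpace ℝ (Fin n) → ℝ)
    (hharm : InnerProductSpace.HarmonicOnNhd h (Metric.ball 0 1))
    (hmaps : Set.MapsTo h (Metric.ball 0 1) (Set.Ioo (-1) 1)) :
    (∀ x ∈ Metric.ball (0 : EuclideanSpace ℝ (Fin n)) 1,
      ‖gradient h x‖ ≤ (n : ℝ) / 2 * ((1 - |h x| ^ 2) / (1 - ‖x‖))) ∧
    (4 ≤ n → ∀ x ∈ Metric.ball (0 : EuclideanSpace ℝ (Fin n)) 1,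
      ‖gradient h x‖ < (n : ℝ) / 2 * ((1 - |h x| ^ 2) / (1 - ‖x‖))) := by
  have hfr : Module.finrank ℝ (EuclideanSpace ℝ (Fin n)) = n := finrank_euclideanSpace_fin
  have key : ∀ x ∈ Metric.ball (0 : EuclideanSpace ℝ (Fin n)) 1,
      (1 - ‖x‖) * ‖gradient h x‖ + ((n : ℝ) - 3) * ((1 - |h x|) ^ 2 / 8) ≤
        n / 2 * (1 - |h x| ^ 2) := fun x hx => by
    have := one_sub_norm_mul_norm_gradient_add_le (by rwa [hfr]) hharm hmaps hx
    rwa [hfr, ← sq_abs (h x)] at this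
  refine ⟨fun x hx => ?_, fun hn4 x hx => ?_⟩
  · have hx1 : 0 < 1 - ‖x‖ := by simpa using hx
    have hn' : (3 : ℝ) ≤ n := by exact_mod_cast hn
    have h2 : 0 ≤ ((n : ℝ) - 3) * ((1 - |h x|) ^ 2 / 8) := mul_nonneg (by linarith) (by positivity)
    rw [← mul_div_assoc, le_div_iff₀ hx1]
    linarith [key x hx]
  · have hx1 : 0 < 1 - ‖x‖ := by simpa using hx
    have hn' : (4 : ℝ) ≤ n := by exact_mod_cast hn4
    have hlt : 0 < 1 - |h x| := sub_pos.2 (abs_lt.2 (hmaps hx))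
    have h2 : 0 < ((n : ℝ) - 3) * ((1 - |h x|) ^ 2 / 8) := mul_pos (by linarith) (by positivity)
    rw [← mul_div_assoc, lt_div_iff₀ hx1]
    linarith [key x hx]
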